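/- Let $H(\mathbb{C})$ be the space of entire functions endowed with the topology of local uniform convergence. For $b\in\mathbb{C}$ let $T_b:H(\mathbb{C})\to H(\mathbb{C})$ be the translation operator $T_b(f)(z)=f(z+b)$, and for a sequence $(T_n)_{n\ge 1}$ of continuous linear operators on $H(\mathbb{C})$ let $HC(\{T_n\})$ be the set of all $f\in H(\mathbb{C})$ such that $\{T_n(f):n\ge 1\}$ is dense in $H(\mathbb{C})$. Let $(\lambda_n)_{n\ge1}$ be a sequence of non-zero complex numbers with $|\lambda_n|\to+\infty$ that satisfies the following condition $(\Sigma)$: for every real $M>0$ there exists a subsequence $(\mu_n)$ of $(\lambda_n)$ such that (i) $|\mu_{n+1}|-|\mu_n|>M$ for every $n=1,2,\ldots$, and (ii) $\sum_{n=1}^{\infty}\frac{1}{|\mu_n|}=+\infty$. Then $$\bigcap_{a\in\mathbb{C}\setminus\{0\}}HC(\{T_{\lambda_n a}\})$$ is a $G_\delta$ and dense subset of $H(\mathbb{C})$. -/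

import Mathlib

open Filter Topology

/-- The space `H(ℂ)` of entire functions, as a linear subspace of `C(ℂ, ℂ)`. It carries the subspace
topology of the compact-open topology, which is the topology of locally uniform convergence. -/
def EntireSpace : Submodule ℂ C(ℂ, ℂ) where
  carrier := {f | Differentiable ℂ (f : ℂ → ℂ)}
  add_mem' := fun hf hg => Differentiable.add hf hg
  zero_mem' := differentiable_const (0 : ℂ)
  smul_mem' := fun c _ hf => Differentiable.const_smul hf c

/-- The translation operator `T_a : H(ℂ) → H(ℂ)`, `T_a(f)(z) = f(z + a)`, as a continuous linear
operator. -/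
noncomputable def translationOp (a : ℂ) : EntireSpace →L[ℂ] EntireSpace where
  toFun f := ⟨⟨fun z => f.1 (z + a), f.1.continuous.comp (continuous_id.add continuous_const)⟩,
    Differentiable.comp (g := (f.1 : ℂ → ℂ)) f.2 (differentiable_id.add_const a)⟩
  map_add' _ _ := rfl
  map_smul' _ _ := rfl
  cont := Continuous.subtype_mk
    ((ContinuousMap.continuous_precomp
      (⟨fun z => z + a, continuous_id.add continuous_const⟩ : C(ℂ, ℂ))).comp
        continuous_subtype_val) _

/-- `HC({T_n})`: the set of hypercyclic vectors of a sequence of continuous linear operators `T_n`,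
that is, of the vectors `x` for which `{T_n x : n}` is dense in the space. -/
def hypercyclicVectors {X : Type*} [AddCommMonoid X] [Module ℂ X] [TopologicalSpace X]
    (T : ℕ → X →L[ℂ] X) : Set X :=
  {x | Dense (Set.range fun n => T n x)}

/-- Condition `(Σ)`: for every `M > 0` there is a subsequence `(μ_n)` of `(lam_n)` with
`|μ_{n+1}| - |μ_n| > M` for all `n` and `∑ 1 / |μ_n| = +∞` (the partial sums tend to `+∞`). -/
def ConditionSigma (lam : ℕ → ℂ) : Prop :=
  ∀ M : ℝ, 0 < M → ∃ k : ℕ → ℕ, StrictMono k ∧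
    (∀ n, M < ‖lam (k (n + 1))‖ - ‖lam (k n)‖) ∧
    Tendsto (fun N => ∑ n ∈ Finset.range N, 1 / ‖lam (k n)‖) atTop atTop

/-! This is a Baire category argument. Exhaust `ℂ \ {0}` by compact annuli `S k` and let `U` run
over a countable basis: the intersection becomes a countable intersection of sets of `f` such that
every `a ∈ S k` has some translate `T_{λ_n a} f` in `U`. These sets are open by compactness, so the
point is their density.

To approximate `g` while some translate comes near `h` for every `a` in the annulus, it suffices to
have finitely many widely separated centres `w`, far from `0`, such that each `a` has some `λ_n a`
within `δ` of a centre (`ConditionSigma.exists_separated_net`). Runge's theorem on the disjoint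
discs (`exists_polynomial_near_of_separated`) then gives one polynomial close to `g` around `0` and
to `h(· - w)` around each `w`.

The net needs the divergent sum. Blocks of `N` consecutive terms cover thin annuli of parameters of
width about `1 / |ν_n|`, so divergence lets the widths add up to the whole annulus. Within a block
each term carries only `M`-separated points on one circle, but the `N` rotated families together are
`N` times finer in angle. -/

/-! ### Connectedness of the complement of separated discs -/

open Metric in
theorem Complex.isPreconnected_ball_diff_closedBall (w : ℂ) {r : ℝ} (hr : 0 ≤ r) (R : ℝ) :
    IsPreconnected (ball w R \ closedBall w r) := by
  have h : ball w R \ closedBall w r =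
      (fun p : ℝ × ℂ => w + p.1 • p.2) '' (Set.Ioo r R ×ˢ sphere (0 : ℂ) 1) := by
    ext z
    simp only [Set.mem_sdiff, mem_ball, mem_closedBall, not_le, Set.mem_image, Set.mem_prod,
      Set.mem_Ioo, mem_sphere_zero_iff_norm, Prod.exists]
    constructor
    · rintro ⟨h1, h2⟩
      have h0 : 0 < ‖z - w‖ := by rw [← dist_eq_norm]; linarith
      refine ⟨‖z - w‖, ‖z - w‖⁻¹ • (z - w), ⟨⟨?_, ?_⟩, ?_⟩, ?_⟩
      · rwa [← dist_eq_norm]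
      · rwa [← dist_eq_norm]
      · rw [norm_smul, norm_inv, norm_norm, inv_mul_cancel₀ h0.ne']
      · rw [smul_inv_smul₀ h0.ne']; ring
    · rintro ⟨t, u, ⟨⟨h1, h2⟩, h3⟩, rfl⟩
      have : dist (w + t • u) w = t := by
        rw [dist_eq_norm, add_sub_cancel_left, norm_smul, h3, mul_one, Real.norm_eq_abs,
          abs_of_pos (by linarith)]
      rw [this]
      exact ⟨h2, h1⟩
  rw [h]
  refine (isPreconnected_Ioo.prod (isPreconnected_sphere ?_ _ _)).image _
    (by fun_prop : Continuous _).continuousOn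
  rw [Complex.rank_real_complex]
  exact Cardinal.one_lt_two

open Metric in
/-- Removing a closed disc from a connected planar set containing a larger disc leaves a
connected set. -/
theorem IsPreconnected.diff_closedBall {U : Set ℂ} (hU : IsPreconnected U) {w : ℂ} {r R : ℝ}
    (hr : 0 ≤ r) (hrR : r < R) (hw : ball w R ⊆ U) : IsPreconnected (U \ closedBall w r) := by
  -- The collar lies in one piece `u` of a separation. Adding the whole disc to `u` yields a
  -- separation of `U` itself, so `v` contributes nothing.
  have key : ∀ u v : Set ℂ, IsOpen u → IsOpen v → U \ closedBall w r ⊆ u ∪ v →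
      U \ closedBall w r ∩ (u ∩ v) = ∅ → ball w R \ closedBall w r ⊆ u →
      U \ closedBall w r ⊆ u := by
    intro u v hu hv hsub hdisj hA
    have hcl : IsOpen (closedBall w r)ᶜ := isClosed_closedBall.isOpen_compl
    have hw0 : w ∈ U := hw (mem_ball_self (by linarith))
    have hcov : U ⊆ (u ∩ (closedBall w r)ᶜ ∪ ball w R) ∪ (v ∩ (closedBall w r)ᶜ) := by
      intro x hx
      by_cases hxr : x ∈ closedBall w r
      · exact Or.inl (Or.inr (closedBall_subset_ball hrR hxr))
      · rcases hsub ⟨hx, hxr⟩ with h | h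
        · exact Or.inl (Or.inl ⟨h, hxr⟩)
        · exact Or.inr ⟨h, hxr⟩
    have hdisj' : U ∩ ((u ∩ (closedBall w r)ᶜ ∪ ball w R) ∩ (v ∩ (closedBall w r)ᶜ)) = ∅ := by
      rw [Set.eq_empty_iff_forall_notMem] at hdisj ⊢
      rintro x ⟨hx, h1, h2⟩
      refine hdisj x ⟨⟨hx, h2.2⟩, ?_, h2.1⟩
      rcases h1 with h1 | h1
      · exact h1.1
      · exact hA ⟨h1, h2.2⟩
    rcases isPreconnected_iff_subset_of_disjoint.1 hU _ _
      ((hu.inter hcl).union isOpen_ball) (hv.inter hcl) hcov hdisj' with h | h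
    · rintro x ⟨hx, hxr⟩
      rcases h hx with h' | h'
      · exact h'.1
      · exact hA ⟨h', hxr⟩
    · exact absurd (mem_closedBall_self hr) (h hw0).2
  rw [isPreconnected_iff_subset_of_disjoint]
  intro u v hu hv hsub hdisj
  have hA : ball w R \ closedBall w r ⊆ U \ closedBall w r := Set.sdiff_subset_sdiff_left hw
  rcases isPreconnected_iff_subset_of_disjoint.1
    (Complex.isPreconnected_ball_diff_closedBall w hr R) u v hu hv (hA.trans hsub)
    (Set.eq_empty_of_subset_empty (hdisj ▸ Set.inter_subset_inter_left _ hA)) with h | h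
  · exact Or.inl (key u v hu hv hsub hdisj h)
  · exact Or.inr (key v u hv hu (by rwa [Set.union_comm]) (by rwa [Set.inter_comm v u]) h)

open Metric in
theorem isPreconnected_compl_biUnion_closedBall (W : Finset ℂ) {r R : ℝ} (hr : 0 ≤ r)
    (hrR : r < R) (hW : ∀ w ∈ W, ∀ w' ∈ W, w ≠ w' → 2 * R ≤ dist w w') :
    IsPreconnected (⋃ w ∈ W, closedBall w r)ᶜ := by
  induction W using Finset.induction_on with
  | empty => simpa using isPreconnected_univ
  | insert a s ha ih =>
    have ih' := ih fun w hw w' hw' =>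
      hW w (Finset.mem_insert_of_mem hw) w' (Finset.mem_insert_of_mem hw')
    have : (⋃ w ∈ insert a s, closedBall w r)ᶜ = (⋃ w ∈ s, closedBall w r)ᶜ \ closedBall a r := by
      rw [Finset.set_biUnion_insert, Set.compl_union, Set.inter_comm, Set.sdiff_eq]
    rw [this]
    refine ih'.diff_closedBall hr hrR fun z hz hz' => ?_
    simp only [Set.mem_iUnion, mem_closedBall, exists_prop] at hz'
    obtain ⟨w, hw, hzw⟩ := hz'
    have h1 := hW a (Finset.mem_insert_self _ _) w (Finset.mem_insert_of_mem hw)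
      (fun h => ha (h ▸ hw))
    have h2 := dist_triangle_left a w z
    rw [mem_ball] at hz
    linarith

/-! ### Runge approximation via the Banach algebra of limits of polynomials -/

open Metric in
/-- Runge's theorem for finitely many separated closed discs of equal radius. -/
theorem exists_polynomial_near_of_separated (W : Finset ℂ) {r R : ℝ} (hr : 0 ≤ r)
    (hrR : r < R) (hW : ∀ w ∈ W, ∀ w' ∈ W, w ≠ w' → 2 * R ≤ dist w w') (F : ℂ → ℂ → ℂ)
    (hF : ∀ w ∈ W, Differentiable ℂ (F w)) {ε : ℝ} (hε : 0 < ε) :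
    ∃ p : Polynomial ℂ, ∀ w ∈ W, ∀ z ∈ closedBall w r, ‖p.eval z - F w z‖ < ε := by
  set K : Set ℂ := ⋃ w ∈ W, closedBall w r with hK
  have hKc : IsCompact K := W.isCompact_biUnion fun w _ => isCompact_closedBall w r
  have : CompactSpace K := isCompact_iff_compactSpace.1 hKc
  let S : Subalgebra ℂ C(K, ℂ) := (polynomialFunctions K).topologicalClosure
  have hSc : IsClosed (S : Set C(K, ℂ)) := Subalgebra.isClosed_topologicalClosure _
  have := hSc
  have : CompleteSpace S := hSc.completeSpace_coe
  let x : S := ⟨Polynomial.X.toContinuousMapOn K,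
    Subalgebra.le_topologicalClosure _ ⟨Polynomial.X, trivial, rfl⟩⟩
  have hx : ∀ z : K, (x : C(K, ℂ)) z = z := fun z => by simp [x]
  have hrange : Set.range (x : C(K, ℂ)) = K := by
    ext z
    constructor
    · rintro ⟨y, rfl⟩
      rw [hx]; exact y.2
    · intro hz
      exact ⟨⟨z, hz⟩, hx _⟩
  -- Passing to a closed subalgebra could only fill holes of the spectrum, and `K` has none. Hence
  -- `(ζ - z)⁻¹` is a uniform limit of polynomials on `K` for every `ζ ∉ K`.
  have hspec : spectrum ℂ x = K := by
    have hs : spectrum ℂ (x : C(K, ℂ)) = K := by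
      rw [ContinuousMap.spectrum_eq_range, hrange]
    refine (Subalgebra.spectrum_eq_of_isPreconnected_compl S x ?_).trans hs
    rw [hs]
    exact isPreconnected_compl_biUnion_closedBall W hr hrR hW
  let ev : K → S →L[ℂ] ℂ := fun z => (ContinuousMap.evalCLM ℂ z).comp S.toSubmodule.subtypeL
  have hev : ∀ z ζ, ζ ∉ K → ev z (resolvent x ζ) = (ζ - z)⁻¹ := by
    intro z ζ hζ
    have h1 : (algebraMap ℂ S ζ - x) * resolvent x ζ = 1 :=
      Ring.mul_inverse_cancel _ (by rw [← hspec] at hζ; exact spectrum.notMem_iff.1 hζ)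
    have h2 := congrArg (fun y : S => (y : C(K, ℂ)) z) h1
    have h3 : (ζ - z) * ev z (resolvent x ζ) = 1 := by
      rw [← hx z]
      exact h2
    exact eq_inv_of_mul_eq_one_right h3
  have hR : 0 < R := hr.trans_lt hrR
  have hsphere : ∀ w ∈ W, ∀ ζ ∈ sphere w R, ζ ∉ K := by
    intro w hw ζ hζ hζK
    simp only [hK, Set.mem_iUnion, mem_closedBall, exists_prop] at hζK
    obtain ⟨w', hw', h⟩ := hζK
    rw [mem_sphere] at hζ
    rcases eq_or_ne w w' with rfl | hne
    · linarith
    · have := hW w hw w' hw' hne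
      have := dist_triangle_left w w' ζ
      linarith
  -- Cauchy integrals taken inside `S`: on the disc about `w` the term of `w` reproduces `F w` and
  -- the other terms vanish.
  let G : S := ∑ w ∈ W, (2 * Real.pi * Complex.I : ℂ)⁻¹ • ∮ ζ in C(w, R), F w ζ • resolvent x ζ
  have hcont : ∀ w ∈ W, ContinuousOn (fun ζ => F w ζ • resolvent x ζ) (sphere w R) := by
    intro w hw
    refine (hF w hw).continuous.continuousOn.smul fun ζ hζ => ?_
    refine (spectrum.hasDerivAt_resolvent_const_left (k := ζ) (a := x)
      ?_).continuousAt.continuousWithinAt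
    have := hsphere w hw ζ hζ
    rw [← hspec] at this
    exact Set.notMem_compl_iff.1 this
  have hGz : ∀ w ∈ W, ∀ z (hz : z ∈ K), z ∈ closedBall w r → (G : C(K, ℂ)) ⟨z, hz⟩ = F w z := by
    intro w hw z hz hzw
    have h1 : ∀ v ∈ W, ev ⟨z, hz⟩ (∮ ζ in C(v, R), F v ζ • resolvent x ζ) =
        ∮ ζ in C(v, R), (ζ - z)⁻¹ • F v ζ := by
      intro v hv
      have hci : CircleIntegrable (fun ζ => F v ζ • resolvent x ζ) v R :=
        (hcont v hv).circleIntegrable hR.le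
      rw [circleIntegral, ← ContinuousLinearMap.intervalIntegral_comp_comm _ hci.out]
      rw [circleIntegral]
      refine intervalIntegral.integral_congr fun θ _ => ?_
      have : circleMap v R θ ∉ K := hsphere v hv _ (circleMap_mem_sphere _ hR.le _)
      simp only [map_smul, hev _ _ this, smul_eq_mul]
      ring
    have h2 : (G : C(K, ℂ)) ⟨z, hz⟩ = ev ⟨z, hz⟩ G := rfl
    rw [h2]
    simp only [G, map_sum, map_smul]
    rw [Finset.sum_eq_single_of_mem w hw]
    · rw [h1 w hw]
      exact Complex.two_pi_I_inv_smul_circleIntegral_sub_inv_smul_of_differentiable_on_off_countable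
        Set.countable_empty (closedBall_subset_ball hrR hzw) (hF w hw).continuous.continuousOn
        fun ζ _ => (hF w hw).differentiableAt
    · intro v hv hvw
      have hne : ∀ ζ ∈ closedBall v R, ζ - z ≠ 0 := by
        intro ζ hζ h0
        obtain rfl := sub_eq_zero.1 h0
        rw [mem_closedBall] at hζ hzw
        have := hW v hv w hw hvw
        have := dist_triangle_left v w ζ
        linarith
      have hd : ∀ ζ ∈ closedBall v R, DifferentiableAt ℂ (fun ζ => (ζ - z)⁻¹ • F v ζ) ζ :=
        fun ζ hζ => ((differentiableAt_id.sub_const z).inv (hne ζ hζ)).smul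
          (hF v hv).differentiableAt
      rw [h1 v hv, Complex.circleIntegral_eq_zero_of_differentiable_on_off_countable hR.le
        Set.countable_empty (fun ζ hζ => (hd ζ hζ).continuousAt.continuousWithinAt)
        fun ζ hζ => hd ζ (ball_subset_closedBall hζ.1), smul_zero]
  have hmem : (G : C(K, ℂ)) ∈ closure ((polynomialFunctions K : Subalgebra ℂ C(K, ℂ)) : Set _) :=
    G.2
  obtain ⟨q, hq, hqd⟩ := Metric.mem_closure_iff.1 hmem ε hε
  obtain ⟨p, -, rfl⟩ := hq
  refine ⟨p, fun w hw z hz => ?_⟩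
  have hzK : z ∈ K := Set.mem_biUnion hw hz
  have := (ContinuousMap.dist_lt_iff hε).1 hqd ⟨z, hzK⟩
  rw [hGz w hw z hzK hz, dist_comm, dist_eq_norm] at this
  simpa using this

/-! ### Equally spaced points on the circle -/

theorem Complex.norm_exp_mul_I_sub_exp_mul_I (x y : ℝ) :
    ‖Complex.exp (x * Complex.I) - Complex.exp (y * Complex.I)‖ = 2 * |Real.sin ((x - y) / 2)| := by
  have h : Complex.exp (x * Complex.I) - Complex.exp (y * Complex.I) =
      Complex.exp (y * Complex.I) * (Complex.exp (Complex.I * ((x - y : ℝ) : ℂ)) - 1) := by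
    rw [mul_sub, ← Complex.exp_add, mul_one]
    congr 2
    push_cast
    ring
  rw [h, norm_mul, Complex.norm_exp_ofReal_mul_I, one_mul, Complex.norm_exp_I_mul_ofReal_sub_one,
    norm_mul, Real.norm_eq_abs, Real.norm_eq_abs, abs_two]

/-- The point of the unit circle with argument `2π(l + i/N)/L`: for fixed `i` these are `L` equally
spaced points, and together they form the `NL`-th roots of unity. -/
noncomputable def circleGrid (N L i l : ℕ) : ℂ :=
  Complex.exp ((2 * Real.pi * ((l + i / N) / L) : ℝ) * Complex.I)

theorem norm_circleGrid (N L i l : ℕ) : ‖circleGrid N L i l‖ = 1 :=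
  Complex.norm_exp_ofReal_mul_I _

theorem four_div_le_norm_circleGrid_sub (N L i : ℕ) {l l' : ℕ} (hl : l < L) (hl' : l' < L)
    (hne : l ≠ l') : 4 / (L : ℝ) ≤ ‖circleGrid N L i l - circleGrid N L i l'‖ := by
  wlog h : l' < l generalizing l l'
  · rw [norm_sub_rev]
    exact this hl' hl hne.symm (by omega)
  have hL : (0 : ℝ) < L := by exact_mod_cast (by omega : 0 < L)
  have hpi := Real.pi_pos
  obtain ⟨d, rfl⟩ := Nat.exists_eq_add_of_lt h
  have hd : ((d : ℝ) + 1) + 1 ≤ L := by exact_mod_cast (by omega : d + 1 + 1 ≤ L)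
  have hang : (2 * Real.pi * ((((l' + d + 1 : ℕ) : ℝ) + i / N) / L) -
      2 * Real.pi * (((l' : ℝ) + i / N) / L)) / 2 = Real.pi * ((d + 1) / L) := by
    push_cast
    field_simp
    ring
  rw [circleGrid, circleGrid, Complex.norm_exp_mul_I_sub_exp_mul_I, hang]
  have h1 : 1 / (L : ℝ) ≤ (d + 1) / L := by gcongr; linarith [(Nat.cast_nonneg d : (0 : ℝ) ≤ d)]
  have h2 : ((d : ℝ) + 1) / L ≤ 1 - 1 / L := by
    rw [div_le_iff₀ hL, sub_mul, one_div, inv_mul_cancel₀ hL.ne']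
    linarith
  have h0 : 0 < 1 / (L : ℝ) := by positivity
  set t : ℝ := (d + 1) / L
  -- Jordan's inequality, applied to `t` or `1 - t`, both of which are at least `1 / L`.
  have key : 2 / (L : ℝ) ≤ Real.sin (Real.pi * t) := by
    have h3 : 2 / (L : ℝ) = 2 * (1 / L) := by ring
    rcases le_total t (1 / 2) with ht | ht
    · have := Real.mul_le_sin (x := Real.pi * t) (by positivity) (by nlinarith)
      have h4 : 2 / Real.pi * (Real.pi * t) = 2 * t := by field_simp
      linarith
    · have := Real.mul_le_sin (x := Real.pi * (1 - t))
        (mul_nonneg hpi.le (by linarith)) (by nlinarith)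
      have h4 : 2 / Real.pi * (Real.pi * (1 - t)) = 2 * (1 - t) := by field_simp
      have h5 : Real.sin (Real.pi * (1 - t)) = Real.sin (Real.pi * t) := by
        rw [mul_sub, mul_one, Real.sin_pi_sub]
      linarith
  have := le_abs_self (Real.sin (Real.pi * t))
  have : 4 / (L : ℝ) = 2 * (2 / L) := by ring
  linarith

theorem exists_norm_sub_circleGrid_le {N L : ℕ} (hN : 0 < N) (hL : 0 < L) {u : ℂ} (hu : ‖u‖ = 1) :
    ∃ i < N, ∃ l < L, ‖u - circleGrid N L i l‖ ≤ 2 * Real.pi / (N * L) := by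
  have hpi := Real.pi_pos
  have hNr : (0 : ℝ) < N := by exact_mod_cast hN
  have hLr : (0 : ℝ) < L := by exact_mod_cast hL
  obtain ⟨s, hs0, hs1, hsu⟩ : ∃ s : ℝ, 0 ≤ s ∧ s < 1 ∧
      u = Complex.exp ((2 * Real.pi * s : ℝ) * Complex.I) := by
    have hu' : u = Complex.exp (u.arg * Complex.I) := by
      conv_lhs => rw [← Complex.norm_mul_exp_arg_mul_I u, hu, Complex.ofReal_one, one_mul]
    have harg1 := Complex.neg_pi_lt_arg u
    have harg2 := Complex.arg_le_pi u
    rcases le_or_gt 0 u.arg with h | h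
    · refine ⟨u.arg / (2 * Real.pi), by positivity, ?_, ?_⟩
      · rw [div_lt_one (by positivity)]
        linarith
      · rw [mul_div_cancel₀ _ (by positivity)]
        exact hu'
    · refine ⟨u.arg / (2 * Real.pi) + 1, ?_, ?_, ?_⟩
      · have : -1 ≤ u.arg / (2 * Real.pi) := by
          rw [le_div_iff₀ (by positivity)]
          linarith
        linarith
      · have : u.arg / (2 * Real.pi) < 0 := div_neg_of_neg_of_pos h (by positivity)
        linarith
      · rw [mul_add, mul_div_cancel₀ _ (by positivity), mul_one, Complex.ofReal_add, add_mul,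
          Complex.exp_add]
        push_cast
        rw [Complex.exp_two_pi_mul_I, mul_one]
        exact hu'
  -- Round down to an `NL`-th root of unity; the remainder of `q` mod `N` selects the family, the
  -- quotient the point in it.
  set q := ⌊s * (N * L)⌋₊ with hq
  have hq1 : (q : ℝ) ≤ s * (N * L) := Nat.floor_le (by positivity)
  have hq2 : s * (N * L) < q + 1 := Nat.lt_floor_add_one _
  have hq3 : q < N * L := by
    have : (q : ℝ) < N * L := by
      refine hq1.trans_lt ?_
      have : (0 : ℝ) < N * L := by positivity
      nlinarith
    exact_mod_cast this
  refine ⟨q % N, Nat.mod_lt _ hN, q / N, Nat.div_lt_of_lt_mul hq3, ?_⟩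
  have hang : (((q / N : ℕ) : ℝ) + ((q % N : ℕ) : ℝ) / N) / L = q / (N * L) := by
    have : (q : ℝ) = N * (q / N : ℕ) + (q % N : ℕ) := by exact_mod_cast (Nat.div_add_mod q N).symm
    rw [this]
    field_simp
  rw [hsu, circleGrid, hang, Complex.norm_exp_mul_I_sub_exp_mul_I]
  have h1 : 0 ≤ s - q / (N * L) := by
    rw [sub_nonneg, div_le_iff₀ (by positivity)]
    exact hq1
  have h2 : s - q / (N * L) ≤ 1 / (N * L) := by
    rw [sub_le_iff_le_add, ← add_div, le_div_iff₀ (by positivity)]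
    linarith
  have h3 := Real.abs_sin_le_abs (x := (2 * Real.pi * s - 2 * Real.pi * (q / (N * L))) / 2)
  have h4 : (2 * Real.pi * s - 2 * Real.pi * (q / (N * L))) / 2 =
    Real.pi * (s - q / (N * L)) := by ring
  rw [h4] at h3 ⊢
  rw [abs_of_nonneg (mul_nonneg hpi.le h1)] at h3
  calc _ ≤ 2 * (Real.pi * (s - q / (N * L))) := by gcongr
    _ ≤ 2 * (Real.pi * (1 / (N * L))) := by gcongr
    _ = _ := by ring

/-! ### Subseries that keep the divergence -/

/-- Divergence of `∑ 1 / μ n` passes to arithmetic progressions when `μ` is monotone. -/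
theorem exists_le_sum_inv_mul {μ : ℕ → ℝ} (hmono : Monotone μ) (hpos : ∀ n, 0 < μ n)
    (hdiv : ∀ B, ∃ n, B ≤ ∑ k ∈ Finset.range n, 1 / μ k) {N : ℕ} (hN : 0 < N) (B : ℝ) :
    ∃ n, B ≤ ∑ j ∈ Finset.range n, 1 / μ (j * N) := by
  have hblock : ∀ J : ℕ, ∑ k ∈ Finset.range (J * N), 1 / μ k ≤
      N * ∑ j ∈ Finset.range J, 1 / μ (j * N) := by
    intro J
    induction J with
    | zero => simp
    | succ J ih =>
      rw [Nat.succ_mul, Finset.sum_range_add, Finset.sum_range_succ, mul_add]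
      refine add_le_add ih ?_
      calc _ ≤ ∑ _i ∈ Finset.range N, 1 / μ (J * N) := Finset.sum_le_sum fun i _ =>
            one_div_le_one_div_of_le (hpos _) (hmono (Nat.le_add_right _ _))
        _ = _ := by simp
  obtain ⟨n, hn⟩ := hdiv (N * B)
  refine ⟨n, le_of_mul_le_mul_left (hn.trans (le_trans ?_ (hblock n))) (by exact_mod_cast hN)⟩
  exact Finset.sum_le_sum_of_subset_of_nonneg
    (Finset.range_mono (Nat.le_mul_of_pos_right n hN)) fun i _ _ => (one_div_pos.2 (hpos i)).le

/-- Divergence of `∑ 1 / m j` is already carried by the indices at which `m` at most doubles. -/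
theorem exists_le_sum_inv_of_le_two_mul {m : ℕ → ℝ} (hmono : Monotone m) (hpos : ∀ n, 0 < m n)
    (hdiv : ∀ B, ∃ n, B ≤ ∑ k ∈ Finset.range n, 1 / m k) (B : ℝ) :
    ∃ n, B ≤ ∑ j ∈ Finset.range n, if m (j + 1) ≤ 2 * m j then 1 / m (j + 1) else 0 := by
  -- When `m` more than doubles, `1 / m (j + 1)` is at most the telescoping difference, so such
  -- indices contribute a bounded sum.
  have hterm : ∀ j, 1 / m (j + 1) ≤
      (if m (j + 1) ≤ 2 * m j then 1 / m (j + 1) else 0) + (1 / m j - 1 / m (j + 1)) := by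
    intro j
    by_cases h : m (j + 1) ≤ 2 * m j
    · rw [if_pos h]
      linarith [one_div_le_one_div_of_le (hpos j) (hmono j.le_succ)]
    · rw [if_neg h]
      push Not at h
      have : 1 / m (j + 1) ≤ 1 / (2 * m j) :=
        one_div_le_one_div_of_le (by linarith [hpos j]) h.le
      have h2 : 1 / (2 * m j) = 1 / m j / 2 := by
        rw [mul_comm, ← div_div]
      linarith
  obtain ⟨n, hn⟩ := hdiv (B + 1 / m 0 + 1 / m 0)
  refine ⟨n, ?_⟩
  have h1 := Finset.sum_le_sum fun j (_ : j ∈ Finset.range n) => hterm j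
  rw [Finset.sum_add_distrib, Finset.sum_range_sub'] at h1
  have h2 := Finset.sum_range_succ (fun k => 1 / m k) n
  rw [Finset.sum_range_succ'] at h2
  have h3 := one_div_pos.2 (hpos n)
  linarith

/-! ### The separated net -/

/-- There is a finite separated set of points such that every `a` in an annulus is carried near one of
them by multiplication by some term of `ν`. -/
theorem exists_separated_net_of_gap {ν : ℕ → ℂ} {r R δ M : ℝ} (hr : 0 < r) (hδ : 0 < δ)
    (hM : 0 < M) (h0 : M ≤ r * ‖ν 0‖) (hgap : ∀ n, M ≤ r * (‖ν (n + 1)‖ - ‖ν n‖))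
    (hdiv : ∀ B, ∃ n, B ≤ ∑ k ∈ Finset.range n, 1 / ‖ν k‖) :
    ∃ W : Finset ℂ, (∀ w ∈ W, r * ‖ν 0‖ ≤ ‖w‖) ∧
      (∀ w ∈ W, ∀ w' ∈ W, w ≠ w' → M ≤ dist w w') ∧
      ∀ a : ℂ, r ≤ ‖a‖ → ‖a‖ ≤ R → ∃ n, ∃ w ∈ W, dist (ν n * a) w < δ := by
  have hpi := Real.pi_pos
  have hmono : Monotone fun n => ‖ν n‖ := monotone_nat_of_le_succ fun n => by
    have := pos_of_mul_pos_right (hM.trans_le (hgap n)) hr.le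
    linarith
  have hpos : ∀ n, 0 < ‖ν n‖ := fun n =>
    (pos_of_mul_pos_right (hM.trans_le h0) hr.le).trans_le (hmono n.zero_le)
  have hgap' : ∀ n n', n < n' → M ≤ r * (‖ν n'‖ - ‖ν n‖) := by
    intro n n' h
    have h1 : ‖ν (n + 1)‖ ≤ ‖ν n'‖ := hmono h
    exact (hgap n).trans (by gcongr)
  -- Chosen so that the angular error in `hB` is at most `δ / 2`.
  obtain ⟨N, hN⟩ := exists_nat_ge (4 * Real.pi * |R| * M / (r * δ) + 1)
  have hNr : (0 : ℝ) < N := lt_of_lt_of_le (by positivity) hN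
  have hN0 : 0 < N := by exact_mod_cast hNr
  set m : ℕ → ℝ := fun j => ‖ν (j * N)‖ with hm
  have hmm : Monotone m := fun i j h => hmono (Nat.mul_le_mul_right N h)
  have hmpos : ∀ j, 0 < m j := fun j => hpos _
  set t : ℕ → ℝ := fun j => if m (j + 1) ≤ 2 * m j then 1 / m (j + 1) else 0 with ht
  have ht0 : ∀ j, 0 ≤ t j := by
    intro j
    simp only [ht]
    split_ifs
    · exact (one_div_pos.2 (hmpos _)).le
    · exact le_rfl
  -- Block `j` handles `ρ j ≤ ‖a‖ < ρ (j + 1)`; this range is empty if `m` more than doubles across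
  -- the block.
  set ρ : ℕ → ℝ := fun j => r + δ / 2 * ∑ i ∈ Finset.range j, t i with hρ
  have hρ0 : ρ 0 = r := by simp [hρ]
  have hρs : ∀ j, ρ (j + 1) = ρ j + δ / 2 * t j := fun j => by
    simp only [hρ, Finset.sum_range_succ]
    ring
  have hρm : Monotone ρ := monotone_nat_of_le_succ fun j => by
    rw [hρs]
    have := mul_nonneg (half_pos hδ).le (ht0 j)
    linarith
  have hρr : ∀ j, r ≤ ρ j := fun j => hρ0 ▸ hρm j.zero_le
  obtain ⟨J, hJ⟩ : ∃ J, R < ρ J := by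
    obtain ⟨J, hJ⟩ := exists_le_sum_inv_of_le_two_mul hmm hmpos
      (exists_le_sum_inv_mul hmono hpos hdiv hN0) (2 / δ * |R|)
    refine ⟨J, ?_⟩
    have h1 : δ / 2 * (2 / δ * |R|) ≤ δ / 2 * ∑ i ∈ Finset.range J, t i := by gcongr
    have h2 : δ / 2 * (2 / δ * |R|) = |R| := by field_simp
    have := le_abs_self R
    simp only [hρ]
    linarith
  -- The upper bound on `L j` gives spacing at least `M`. The real number is at least `4`, so the
  -- floor keeps half of it, which bounds the angular step.
  set L : ℕ → ℕ := fun j => ⌊4 * r * m j / M⌋₊ with hLdef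
  have hLx : ∀ j, 4 ≤ 4 * r * m j / M := fun j => by
    rw [le_div_iff₀ hM]
    have : ‖ν 0‖ ≤ m j := hmono (Nat.zero_le _)
    have := h0.trans (mul_le_mul_of_nonneg_left this hr.le)
    linarith
  have hL1 : ∀ j, (L j : ℝ) ≤ 4 * r * m j / M := fun j => Nat.floor_le (by linarith [hLx j])
  have hL2 : ∀ j, 2 * r * m j / M ≤ L j := fun j => by
    have h1 := Nat.lt_floor_add_one (4 * r * m j / M)
    have h2 : 2 * r * m j / M = (4 * r * m j / M) / 2 := by ring
    have h3 := hLx j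
    have h4 : 4 * r * m j / M < L j + 1 := h1
    linarith
  have hLpos : ∀ j, (0 : ℝ) < L j := fun j => lt_of_lt_of_le
    (by have := hmpos j; positivity) (hL2 j)
  set P : ℕ → ℕ → ℂ := fun n l => ρ (n / N) * ν n * circleGrid N (L (n / N)) (n % N) l with hP
  have hPn : ∀ n l, ‖P n l‖ = ρ (n / N) * ‖ν n‖ := fun n l => by
    simp only [hP]
    rw [norm_mul, norm_mul, norm_circleGrid, mul_one, Complex.norm_real, Real.norm_eq_abs,
      abs_of_nonneg (hr.le.trans (hρr _))]
  have hsep : ∀ n n' l l', n < n' → M ≤ dist (P n l) (P n' l') := by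
    intro n n' l l' h
    have h1 := norm_sub_norm_le (P n' l') (P n l)
    rw [hPn, hPn, ← dist_eq_norm, dist_comm] at h1
    have h2 : ρ (n / N) * ‖ν n'‖ ≤ ρ (n' / N) * ‖ν n'‖ := by
      gcongr
      exact hρm (Nat.div_le_div_right h.le)
    have h3 : 0 ≤ ‖ν n'‖ - ‖ν n‖ := sub_nonneg.2 (hmono h.le)
    have h4 := mul_le_mul_of_nonneg_right (hρr (n / N)) h3
    have h5 := hgap' n n' h
    linarith
  refine ⟨(Finset.range (J * N)).biUnion fun n => (Finset.range (L (n / N))).image (P n),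
    ?_, ?_, ?_⟩
  · intro w hw
    simp only [Finset.mem_biUnion, Finset.mem_image, Finset.mem_range] at hw
    obtain ⟨n, -, l, -, rfl⟩ := hw
    rw [hPn]
    exact mul_le_mul (hρr _) (hmono n.zero_le) (norm_nonneg _) (hr.le.trans (hρr _))
  · intro w hw w' hw' hne
    simp only [Finset.mem_biUnion, Finset.mem_image, Finset.mem_range] at hw hw'
    obtain ⟨n, -, l, hl, rfl⟩ := hw
    obtain ⟨n', -, l', hl', rfl⟩ := hw'
    rcases lt_trichotomy n n' with h | rfl | h
    · exact hsep _ _ _ _ h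
    · have hll : l ≠ l' := fun h => hne (h ▸ rfl)
      have h1 := four_div_le_norm_circleGrid_sub N (L (n / N)) (n % N) hl hl' hll
      have h2 : dist (P n l) (P n l') = ρ (n / N) * ‖ν n‖ *
          ‖circleGrid N (L (n / N)) (n % N) l - circleGrid N (L (n / N)) (n % N) l'‖ := by
        rw [dist_eq_norm]
        simp only [hP]
        rw [← mul_sub, norm_mul, norm_mul, Complex.norm_real, Real.norm_eq_abs,
          abs_of_nonneg (hr.le.trans (hρr _))]
      rw [h2]
      have h3 : m (n / N) ≤ ‖ν n‖ := hmono (Nat.div_mul_le_self n N)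
      calc M ≤ r * m (n / N) * (4 / L (n / N)) := by
            rw [← mul_div_assoc, le_div_iff₀ (hLpos _), mul_comm M, ← le_div_iff₀ hM]
            exact (hL1 _).trans_eq (by ring)
        _ ≤ _ := by
            refine mul_le_mul (mul_le_mul (hρr _) h3 (hmpos _).le (hr.le.trans (hρr _))) h1
              (by positivity) (mul_nonneg (hr.le.trans (hρr _)) (norm_nonneg _))
    · rw [dist_comm]
      exact hsep _ _ _ _ h
  · intro a ha1 ha2
    have ha : 0 < ‖a‖ := hr.trans_le ha1
    obtain ⟨j, hjJ, hj1, hj2⟩ : ∃ j < J, ρ j ≤ ‖a‖ ∧ ‖a‖ < ρ (j + 1) := by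
      have hex : ∃ j, ‖a‖ < ρ j := ⟨J, ha2.trans_lt hJ⟩
      classical
      have hf := Nat.find_spec hex
      have hf0 : Nat.find hex ≠ 0 := fun h => by
        rw [h, hρ0] at hf
        linarith
      obtain ⟨j, hj⟩ := Nat.exists_eq_succ_of_ne_zero hf0
      have hle : Nat.find hex ≤ J := Nat.find_min' hex (ha2.trans_lt hJ)
      refine ⟨j, by omega, not_lt.1 (Nat.find_min hex (by omega)), ?_⟩
      rw [hj] at hf
      exact hf
    have hgood : m (j + 1) ≤ 2 * m j := by
      by_contra h
      have : t j = 0 := if_neg h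
      rw [hρs, this, mul_zero, add_zero] at hj2
      linarith
    have htj : t j = 1 / m (j + 1) := if_pos hgood
    obtain ⟨i, hi, l, hl, hil⟩ := exists_norm_sub_circleGrid_le (u := a / ‖a‖) hN0
      (L := L j) (by exact_mod_cast hLpos j)
      (by rw [norm_div, Complex.norm_real, norm_norm, div_self ha.ne'])
    have hdivN : (j * N + i) / N = j := by
      rw [mul_comm, Nat.mul_add_div hN0, Nat.div_eq_of_lt hi, add_zero]
    have hmodN : (j * N + i) % N = i := by
      rw [mul_comm, Nat.mul_add_mod, Nat.mod_eq_of_lt hi]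
    refine ⟨j * N + i, P (j * N + i) l, ?_, ?_⟩
    · simp only [Finset.mem_biUnion, Finset.mem_image, Finset.mem_range]
      refine ⟨j * N + i, ?_, l, by rwa [hdivN], rfl⟩
      calc j * N + i < j * N + N := by omega
        _ = (j + 1) * N := by ring
        _ ≤ J * N := Nat.mul_le_mul_right N hjJ
    · have hν1 : ‖ν (j * N + i)‖ ≤ m (j + 1) := hmono (by
        rw [add_mul, one_mul]
        omega)
      have hν2 := hν1.trans hgood
      set g := circleGrid N (L j) i l with hg
      -- Radial error plus angular error, each to be bounded by `δ / 2` after scaling by `‖ν n‖`.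
      have hdecomp : ν (j * N + i) * a - P (j * N + i) l =
          ν (j * N + i) * ((‖a‖ - ρ j : ℝ) * g + ‖a‖ * (a / ‖a‖ - g)) := by
        have : (‖a‖ : ℂ) ≠ 0 := by exact_mod_cast ha.ne'
        simp only [hP, hdivN, hmodN, ← hg]
        push_cast
        field_simp
        ring
      have hA : ‖ν (j * N + i)‖ * (‖a‖ - ρ j) < δ / 2 := by
        rw [hρs, htj] at hj2
        calc _ < ‖ν (j * N + i)‖ * (δ / 2 * (1 / m (j + 1))) := by
              refine mul_lt_mul_of_pos_left ?_ (hpos _)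
              linarith
          _ ≤ m (j + 1) * (δ / 2 * (1 / m (j + 1))) := by
              have := hmpos (j + 1)
              gcongr
          _ = δ / 2 := by
              have := (hmpos (j + 1)).ne'
              field_simp
      have hB : ‖ν (j * N + i)‖ * (‖a‖ * (2 * Real.pi / (N * L j))) ≤ δ / 2 := by
        have hmj := hmpos j
        have hRa : ‖a‖ ≤ |R| := ha2.trans (le_abs_self R)
        calc _ ≤ 2 * m j * (|R| * (2 * Real.pi / (N * (2 * r * m j / M)))) := by
              have := hL2 j
              gcongr
          _ = 2 * Real.pi * |R| * M / (N * r) := by field_simp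
          _ ≤ δ / 2 := by
              rw [div_le_iff₀ (by positivity)]
              have h1 : 4 * Real.pi * |R| * M / (r * δ) ≤ N := by linarith
              rw [div_le_iff₀ (by positivity)] at h1
              linarith
      rw [dist_eq_norm, hdecomp, norm_mul]
      have hn : ‖(‖a‖ - ρ j : ℝ) * g + ‖a‖ * (a / ‖a‖ - g)‖ ≤
          (‖a‖ - ρ j) + ‖a‖ * (2 * Real.pi / (N * L j)) := by
        refine (norm_add_le _ _).trans (add_le_add ?_ ?_)
        · rw [norm_mul, hg, norm_circleGrid, mul_one, Complex.norm_real, Real.norm_eq_abs,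
            abs_of_nonneg (sub_nonneg.2 hj1)]
        · rw [norm_mul, Complex.norm_real, norm_norm]
          gcongr
      have := mul_le_mul_of_nonneg_left hn (norm_nonneg (ν (j * N + i)))
      rw [mul_add] at this
      linarith

/-- Under condition `(Σ)` every annulus of parameters is captured by a finite set of points,
arbitrarily far from the origin and arbitrarily well separated. -/
theorem ConditionSigma.exists_separated_net {lam : ℕ → ℂ} (hsig : ConditionSigma lam)
    {r δ M : ℝ} (R : ℝ) (hr : 0 < r) (hδ : 0 < δ) (hM : 0 < M) :
    ∃ W : Finset ℂ, (∀ w ∈ W, M ≤ ‖w‖) ∧ (∀ w ∈ W, ∀ w' ∈ W, w ≠ w' → M ≤ dist w w') ∧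
      ∀ a : ℂ, r ≤ ‖a‖ → ‖a‖ ≤ R → ∃ n, ∃ w ∈ W, dist (lam n * a) w < δ := by
  obtain ⟨k, -, hgap, hdiv⟩ := hsig (M / r) (by positivity)
  have hgap' : ∀ n, M ≤ r * (‖lam (k (n + 1))‖ - ‖lam (k n)‖) := fun n => by
    have := hgap n
    rw [div_lt_iff₀ hr] at this
    linarith
  have h1 : M ≤ r * ‖lam (k 1)‖ := (hgap' 0).trans (by
    gcongr
    linarith [norm_nonneg (lam (k 0))])
  -- The first term is dropped, since only from the second on does the gap force `M ≤ r * ‖ν n‖`.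
  obtain ⟨W, hW0, hW1, hW2⟩ := exists_separated_net_of_gap (ν := fun n => lam (k (n + 1))) (R := R)
    hr hδ hM h1 (fun n => hgap' (n + 1)) (fun B => by
      obtain ⟨n, hn, hn1⟩ := ((hdiv.eventually_ge_atTop (B + 1 / ‖lam (k 0)‖)).and
        (eventually_ge_atTop 1)).exists
      obtain ⟨n, rfl⟩ := Nat.exists_eq_add_of_le' hn1
      rw [Finset.sum_range_succ'] at hn
      exact ⟨n, by linarith⟩)
  refine ⟨W, fun w hw => h1.trans (hW0 w hw), hW1, fun a ha ha' => ?_⟩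
  obtain ⟨n, w, hw, h⟩ := hW2 a ha ha'
  exact ⟨_, w, hw, h⟩

/-! ### Topology of the space of entire functions -/

theorem EntireSpace.isClosed : IsClosed (EntireSpace : Set C(ℂ, ℂ)) := by
  refine IsSeqClosed.isClosed fun u f hu hf => ?_
  have h := ContinuousMap.tendsto_iff_tendstoLocallyUniformly.1 hf
  rw [← tendstoLocallyUniformlyOn_univ] at h
  exact differentiableOn_univ.1 (h.differentiableOn
    (Eventually.of_forall fun n => (hu n : Differentiable ℂ (u n)).differentiableOn) isOpen_univ)

instance : BaireSpace EntireSpace := by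
  have : CompleteSpace EntireSpace := EntireSpace.isClosed.completeSpace_coe
  have : (uniformity EntireSpace).IsCountablyGenerated := Filter.comap.isCountablyGenerated _ _
  let := UniformSpace.pseudoMetricSpace EntireSpace
  infer_instance

instance : SecondCountableTopology EntireSpace := by
  have : SecondCountableTopology C(ℂ, ℂ) := inferInstance
  exact TopologicalSpace.Subtype.secondCountableTopology _

/-- Neighborhoods in the space of entire functions contain uniform neighborhoods on discs. -/
theorem EntireSpace.exists_ball_subset {V : Set EntireSpace} (hV : IsOpen V) {g : EntireSpace}
    (hg : g ∈ V) : ∃ ρ > 0, ∃ ε > 0, ∀ ρ' ≥ ρ, ∀ ε' ≤ ε, ∀ f : EntireSpace,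
      (∀ z ∈ Metric.closedBall (0 : ℂ) ρ', ‖f.1 z - g.1 z‖ < ε') → f ∈ V := by
  obtain ⟨O, hO, rfl⟩ := isOpen_induced_iff.1 hV
  obtain ⟨X, hX, hXO⟩ := UniformSpace.mem_nhds_iff.1 (hO.mem_nhds hg)
  obtain ⟨K, D, hK, hD, hKD⟩ := (ContinuousMap.mem_compactConvergence_entourage_iff X).1 hX
  obtain ⟨ε, hε, hεD⟩ := Metric.mem_uniformity_dist.1 hD
  obtain ⟨ρ, hρ, hKρ⟩ := hK.isBounded.subset_closedBall_lt 0 0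
  refine ⟨ρ, hρ, ε, hε, fun ρ' hρ' ε' hε' f hf => hXO (hKD fun z hz => hεD ?_)⟩
  rw [dist_comm, dist_eq_norm]
  exact (hf z (Metric.closedBall_subset_closedBall hρ' (hKρ hz))).trans_le hε'

theorem continuous_translationOp_apply :
    Continuous fun p : EntireSpace × ℂ => translationOp p.2 p.1 := by
  refine Continuous.subtype_mk ?_ _
  refine ContinuousMap.continuous_of_continuous_uncurry _ ?_
  change Continuous fun q : (EntireSpace × ℂ) × ℂ => (q.1.1 : C(ℂ, ℂ)) (q.2 + q.1.2)
  fun_prop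

/-! ### The Baire category argument -/

/-- By joint continuity in `(f, a)` the same `n` works near each pair; compactness of `S` makes the
neighbourhood of `f` uniform in `a`. -/
theorem isOpen_setOf_forall_exists_translationOp_mem {S : Set ℂ} (hS : IsCompact S) (lam : ℕ → ℂ)
    {U : Set EntireSpace} (hU : IsOpen U) :
    IsOpen {f | ∀ a ∈ S, ∃ n, translationOp (lam n * a) f ∈ U} := by
  rw [isOpen_iff_mem_nhds]
  intro f hf
  refine hS.eventually_forall_of_forall_eventually
    (P := fun f a => ∃ n, translationOp (lam n * a) f ∈ U) fun a ha => ?_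
  obtain ⟨n, hn⟩ := hf a ha
  have hc : Continuous fun p : EntireSpace × ℂ => translationOp (lam n * p.2) p.1 :=
    continuous_translationOp_apply.comp (by fun_prop :
      Continuous fun p : EntireSpace × ℂ => (p.1, lam n * p.2))
  filter_upwards [(hU.preimage hc).mem_nhds hn] with p hp
  exact ⟨n, hp⟩

theorem dense_setOf_forall_exists_translationOp_mem {lam : ℕ → ℂ} (hsig : ConditionSigma lam)
    {r : ℝ} (hr : 0 < r) (R : ℝ) {U : Set EntireSpace} (hU : IsOpen U) (hUne : U.Nonempty) :
    Dense {f | ∀ a : ℂ, r ≤ ‖a‖ → ‖a‖ ≤ R → ∃ n, translationOp (lam n * a) f ∈ U} := by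
  rw [dense_iff_inter_open]
  rintro V hV ⟨g, hg⟩
  obtain ⟨h, hh⟩ := hUne
  obtain ⟨ρ₁, hρ₁, ε₁, hε₁, hV'⟩ := EntireSpace.exists_ball_subset hV hg
  obtain ⟨ρ₂, -, ε₂, hε₂, hU'⟩ := EntireSpace.exists_ball_subset hU hh
  set ρ := max ρ₁ ρ₂
  set ε := min ε₁ ε₂
  have hρ : 0 < ρ := hρ₁.trans_le (le_max_left _ _)
  have hε : 0 < ε := lt_min hε₁ hε₂
  obtain ⟨δ, hδ, hδh⟩ := Metric.uniformContinuousOn_iff.1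
    ((isCompact_closedBall (0 : ℂ) (ρ + 1)).uniformContinuousOn_of_continuous
      h.1.continuous.continuousOn) (ε / 2) (half_pos hε)
  -- `M` is twice the outer radius `ρ + 2` required for Runge. The cap `1` on the error keeps `z +
  -- λ_n a` in the disc of radius `ρ + 1` about `w` when `‖z‖ ≤ ρ`.
  obtain ⟨W, hW0, hW1, hW2⟩ := hsig.exists_separated_net (δ := min δ 1) (M := 2 * (ρ + 2)) R hr
    (lt_min hδ one_pos) (by positivity)
  have h0W : (0 : ℂ) ∉ W := fun h0 => by
    have := hW0 0 h0
    rw [norm_zero] at this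
    linarith
  have hhd : Differentiable ℂ (h.1 : ℂ → ℂ) := h.2
  obtain ⟨p, hp⟩ := exists_polynomial_near_of_separated (insert 0 W) (r := ρ + 1) (R := ρ + 2)
    (by linarith) (by linarith) (by
      intro w hw w' hw' hne
      rw [Finset.mem_insert] at hw hw'
      rcases hw with rfl | hw <;> rcases hw' with rfl | hw'
      · exact absurd rfl hne
      · simpa using hW0 w' hw'
      · simpa using hW0 w hw
      · exact hW1 w hw w' hw' hne)
    (fun w => if w = 0 then g.1 else fun z => h.1 (z - w)) (by
      intro w _
      split_ifs
      · exact g.2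
      · exact hhd.comp (differentiable_id.sub_const w)) (half_pos hε)
  let f : EntireSpace := ⟨p.toContinuousMap, p.differentiable⟩
  have hf : ∀ z, f.1 z = p.eval z := fun z => rfl
  refine ⟨f, hV' ρ (le_max_left _ _) ε (min_le_left _ _) f fun z hz => ?_,
    fun a ha ha' => ?_⟩
  · have := hp 0 (Finset.mem_insert_self _ _) z
      (Metric.closedBall_subset_closedBall (by linarith) hz)
    rw [if_pos rfl] at this
    rw [hf]
    linarith
  · obtain ⟨n, w, hw, hd⟩ := hW2 a ha ha'
    refine ⟨n, hU' ρ (le_max_right _ _) ε (min_le_right _ _) _ fun z hz => ?_⟩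
    have hd1 := hd.trans_le (min_le_left _ _)
    have hd2 := hd.trans_le (min_le_right _ _)
    rw [dist_eq_norm] at hd1 hd2
    rw [mem_closedBall_zero_iff] at hz
    have hz1 : ‖z + lam n * a - w‖ ≤ ρ + 1 := by
      rw [add_sub_assoc]
      exact (norm_add_le _ _).trans (by linarith)
    have e1 := hp w (Finset.mem_insert_of_mem hw) (z + lam n * a) (by
      rwa [mem_closedBall_iff_norm])
    rw [if_neg (ne_of_mem_of_not_mem hw h0W)] at e1
    have e2 := hδh (z + lam n * a - w) (by rwa [mem_closedBall_zero_iff]) z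
      (by rw [mem_closedBall_zero_iff]; linarith) (by
        rw [dist_eq_norm, show z + lam n * a - w - z = lam n * a - w by ring]
        exact hd1)
    rw [dist_eq_norm] at e2
    change ‖p.eval (z + lam n * a) - h.1 z‖ < ε
    have := norm_sub_le_norm_sub_add_norm_sub (p.eval (z + lam n * a)) (h.1 (z + lam n * a - w))
      (h.1 z)
    linarith

theorem theorem2p1 (lam : ℕ → ℂ) (hne : ∀ n, lam n ≠ 0)
    (hlim : Tendsto (fun n => ‖lam n‖) atTop atTop) (hsig : ConditionSigma lam) :
    IsGδ (⋂ a ∈ ({0}ᶜ : Set ℂ), hypercyclicVectors fun n => translationOp (lam n * a)) ∧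
    Dense (⋂ a ∈ ({0}ᶜ : Set ℂ), hypercyclicVectors fun n => translationOp (lam n * a)) := by
  set B := TopologicalSpace.countableBasis EntireSpace
  have hB : TopologicalSpace.IsTopologicalBasis B :=
    TopologicalSpace.isBasis_countableBasis EntireSpace
  have hBc : B.Countable := TopologicalSpace.countable_countableBasis EntireSpace
  let S : ℕ → Set ℂ := fun k => {a | 1 / ((k : ℝ) + 1) ≤ ‖a‖ ∧ ‖a‖ ≤ k + 1}
  have hS : ∀ k, IsCompact (S k) := fun k =>
    (isCompact_closedBall (0 : ℂ) (k + 1)).of_isClosed_subset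
      ((isClosed_le continuous_const continuous_norm).inter
        (isClosed_le continuous_norm continuous_const))
      fun a ha => mem_closedBall_zero_iff.2 ha.2
  have heq : (⋂ a ∈ ({0}ᶜ : Set ℂ), hypercyclicVectors fun n => translationOp (lam n * a)) =
      ⋂ U ∈ B, ⋂ k, {f | ∀ a ∈ S k, ∃ n, translationOp (lam n * a) f ∈ U} := by
    ext f
    simp only [Set.mem_iInter, hypercyclicVectors, Set.mem_ofPred_eq, Set.mem_compl_iff,
      Set.mem_singleton_iff]
    constructor
    · intro hf U hU k a ha
      have ha0 : a ≠ 0 := norm_pos_iff.1 (lt_of_lt_of_le (by positivity) ha.1)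
      obtain ⟨_, hu, n, rfl⟩ := (hf a ha0).inter_open_nonempty U
        (hB.isOpen hU) (TopologicalSpace.nonempty_of_mem_countableBasis hU)
      exact ⟨n, hu⟩
    · intro hf a ha0
      rw [hB.dense_iff]
      intro U hU _
      obtain ⟨k, hk⟩ := exists_nat_ge (max ‖a‖ (1 / ‖a‖))
      have hpos := norm_pos_iff.2 ha0
      have hk2 : 1 / ‖a‖ ≤ (k : ℝ) + 1 := by linarith [le_max_right ‖a‖ (1 / ‖a‖)]
      obtain ⟨n, hn⟩ := hf U hU k a
        ⟨(one_div_le hpos (by positivity)).1 hk2, by linarith [le_max_left ‖a‖ (1 / ‖a‖)]⟩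
      exact ⟨_, hn, n, rfl⟩
  have hopen : ∀ U ∈ B, ∀ k, IsOpen {f | ∀ a ∈ S k, ∃ n, translationOp (lam n * a) f ∈ U} :=
    fun U hU k => isOpen_setOf_forall_exists_translationOp_mem (hS k) lam (hB.isOpen hU)
  rw [heq]
  refine ⟨.biInter hBc fun U hU => .iInter_of_isOpen fun k => hopen U hU k,
    dense_biInter_of_Gδ (fun U hU => .iInter_of_isOpen fun k => hopen U hU k) hBc fun U hU =>
      dense_iInter_of_isOpen (fun k => hopen U hU k) fun k => ?_⟩
  refine (dense_setOf_forall_exists_translationOp_mem hsig (r := 1 / ((k : ℝ) + 1))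
    (by positivity) (k + 1) (hB.isOpen hU)
    (TopologicalSpace.nonempty_of_mem_countableBasis hU)).mono ?_
  exact fun f hf a ha => hf a ha.1 ha.2
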